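/- Let $\Theta$ be a finite set and let $(\mathcal X,\nu)$ be a $\sigma$-finite measure space. For each $\theta\in\Theta$ let $p(\cdot\mid\theta)$ be a probability density on $\mathcal X$ with respect to $\nu$ such that $p(\cdot\mid\theta)>0$ $\nu$-a.e. (no boundedness of $p$ is assumed). Write $\Delta=\{\varphi:\Theta\to[0,1] : \sum_{\theta}\varphi(\theta)=1\}$ for the set of probability densities on $\Theta$ with respect to counting measure, and, for $\varphi\in\Delta$, let $\Pi_\varphi(x)=\sum_{\theta\in\Theta}p(x\mid\theta)\varphi(\theta)$ be the mixture density. Assume that the mixture is identifiable: if $\varphi,\psi\in\Delta$ and $\Pi_\varphi=\Pi_\psi$ $\nu$-a.e., then $\varphi=\psi$. Let $f\in\Delta$ (some of the values $f(\theta)$ may be zero), and let $X_1,X_2,\dots$ be i.i.d. $\mathcal X$-valued random variables with density $\Pi_f$ with respect to $\nu$. Let $w_1,w_2,\dots\in(0,1)$ satisfy $\sum_n w_n=\infty$ and $\sum_n w_n^2<\infty$, let $f_0\in\Delta$ with $f_0(\theta)>0$ for every $\theta\in\Theta$, and let $f_n$ be Newton's recursive estimate, defined for $n\ge 1$ by $$f_n(\theta)=(1-w_n)f_{n-1}(\theta)+w_n\,\frac{p(X_n\mid\theta)f_{n-1}(\theta)}{\Pi_{f_{n-1}}(X_n)},\qquad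 \theta\in\Theta.$$ Then, almost surely, $f_n(\theta)\to f(\theta)$ as $n\to\infty$ for every $\theta\in\Theta$. -/

import Mathlib

open MeasureTheory ProbabilityTheory Filter Topology

noncomputable section

namespace NewtonMixing

variable {𝒳 Θ : Type*}

/-- `g` is a probability density on `𝒳` with respect to `ν`. -/
structure IsProbDensity [MeasurableSpace 𝒳] (ν : Measure 𝒳) (g : 𝒳 → ℝ) : Prop where
  measurable : Measurable g
  nonneg : ∀ x, 0 ≤ g x
  lintegral_eq_one : ∫⁻ x, ENNReal.ofReal (g x) ∂ν = 1

variable [Fintype Θ]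

/-- The mixture density `Π_φ(x) = ∑_θ p(x|θ) φ(θ)`; `p x θ` stands for `p(x|θ)`, and the
integral over `Θ` with respect to counting measure is a finite sum. -/
def mixture (p : 𝒳 → Θ → ℝ) (φ : Θ → ℝ) (x : 𝒳) : ℝ :=
  ∑ θ, p x θ * φ θ

/-- Identifiability: the map `φ ↦ Π_φ` from probability vectors on `Θ` to densities
(which are identified when they agree `ν`-a.e.) is injective. -/
def Identifiable [MeasurableSpace 𝒳] (ν : Measure 𝒳) (p : 𝒳 → Θ → ℝ) : Prop :=
  ∀ φ ∈ stdSimplex ℝ Θ, ∀ ψ ∈ stdSimplex ℝ Θ,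
    mixture p φ =ᵐ[ν] mixture p ψ → φ = ψ

/-- Newton's recursive estimate computed from the data `x`. The entries `w n`, `x n` of the
sequences (indexed from `0`) are the weight and the observation used in the step that leads
from the `n`-th estimate to the `(n + 1)`-st. -/
def newtonEstimate (p : 𝒳 → Θ → ℝ) (w : ℕ → ℝ) (f₀ : Θ → ℝ) (x : ℕ → 𝒳) : ℕ → Θ → ℝ
  | 0 => f₀
  | n + 1 => fun θ =>
      (1 - w n) * newtonEstimate p w f₀ x n θ
        + w n * (p (x n) θ * newtonEstimate p w f₀ x n θ
            / mixture p (newtonEstimate p w f₀ x n) (x n))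

end NewtonMixing

end

/-! The Lyapunov function is `∑ f log φ`, the negative Kullback-Leibler divergence of `φ` from `f`
up to a constant. One step multiplies `φ θ` by `1 - w + w u` with `u = p / Π_φ`. Since `p` may be
unbounded, a direct second-order expansion of the logarithm leaves an uncontrolled remainder.
Monotonicity of `log` allows `u` to be replaced by the smaller `v = (p / Π_f) * R`, where `R = min
(Π_f / Π_φ) 2`. Because `p * f θ ≤ Π_f`, this `v` is at most `2 / f θ`, and its `f`-average is
exactly `R`. Hence the gain is at least `w (R - 1) - C w ^ 2 / (1 - w)` (`newton_step_gain`).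

Under the true law `R - 1` has nonnegative mean, and the mean vanishes only if `Π_φ = Π_f` a.e.,
that is, `φ = f` (`eq_of_drift_eq_zero`). The centred part is bounded, so its `w`-weighted sums form
an `L²`-bounded martingale, which converges (`ae_exists_tendsto_sum_innovations`).

What remains is deterministic (`tendsto_of_drift`): the Lyapunov values converge, divergence of `∑
w` forces the drift near `0` infinitely often, compactness makes `f` a cluster point, and the limit
of the Lyapunov values is therefore its maximum, attained only at `f`. -/

noncomputable section

namespace NewtonMixing

/-! ### Martingale convergence of the noise -/

section Noise

variable {Ω 𝒳 E : Type*} [mΩ : MeasurableSpace Ω] [m𝒳 : MeasurableSpace 𝒳] [MeasurableSpace E]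

/-- The filtration whose `n`-th member is generated by the observations strictly before `n`. -/
def strictPast (X : ℕ → Ω → 𝒳) (hX : ∀ n, Measurable (X n)) : Filtration ℕ mΩ where
  seq n := ⨆ i ∈ Set.Iio n, m𝒳.comap (X i)
  mono' _ _ hmn := biSup_mono fun _ hi => lt_of_lt_of_le hi hmn
  le' _ := iSup₂_le fun i _ => (hX i).comap_le

variable {X : ℕ → Ω → 𝒳} {hX : ∀ n, Measurable (X n)} {P : Measure Ω}

theorem measurable_strictPast {i n : ℕ} (h : i < n) : Measurable[strictPast X hX n] (X i) :=
  Measurable.mono (comap_measurable (X i))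
    (le_iSup₂_of_le (f := fun i (_ : i ∈ Set.Iio n) => m𝒳.comap (X i)) i h le_rfl) le_rfl

theorem indepFun_of_measurable_strictPast (hind : iIndepFun X P) {n : ℕ} {U : Ω → E}
    (hU : Measurable[strictPast X hX n] U) : IndepFun U (X n) P := by
  have h := indep_iSup_of_disjoint (fun i => (hX i).comap_le)
    ((iIndepFun_iff_iIndep _ _ _).1 hind) (S := Set.Iio n) (T := {n}) (by simp)
  rw [IndepFun_iff_Indep]
  exact indep_of_indep_of_le_left (indep_of_indep_of_le_right h (by simp)) hU.comap_le

variable [IsProbabilityMeasure P]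

/-- A bounded function of the past and the present observation, centred in the latter, is
orthogonal to the past. -/
theorem integral_mul_eq_zero_of_strictPast {μ : Measure 𝒳} (hind : iIndepFun X P)
    {n : ℕ} (hlaw : P.map (X n) = μ) {U : Ω → ℝ} {Z : Ω → E}
    (hU : Measurable[strictPast X hX n] U) (hZ : Measurable[strictPast X hX n] Z)
    {C : ℝ} (hUC : ∀ ω, |U ω| ≤ C)
    {g : E → 𝒳 → ℝ} (hg : Measurable (Function.uncurry g)) {B : ℝ} (hgB : ∀ z x, |g z x| ≤ B)
    (hg0 : ∀ z, ∫ x, g z x ∂μ = 0) :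
    ∫ ω, U ω * g (Z ω) (X n ω) ∂P = 0 := by
  have hUm : Measurable U := hU.mono ((strictPast X hX).le n) le_rfl
  have hZm : Measurable Z := hZ.mono ((strictPast X hX).le n) le_rfl
  have hUZ : Measurable[strictPast X hX n] (fun ω => (U ω, Z ω)) := hU.prodMk hZ
  have hUZm : Measurable (fun ω => (U ω, Z ω)) := hUm.prodMk hZm
  have hmap := (indepFun_of_measurable_strictPast hind hUZ).map_prod_eq_prod_map_map
    hUZm.aemeasurable (hX n).aemeasurable
  have hG : Measurable (fun y : (ℝ × E) × 𝒳 => y.1.1 * g y.1.2 y.2) :=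
    (measurable_fst.comp measurable_fst).mul
      (hg.comp ((measurable_snd.comp measurable_fst).prodMk measurable_snd))
  have hpair : Measurable (fun ω => ((U ω, Z ω), X n ω)) := hUZm.prodMk (hX n)
  have key : ∫ ω, U ω * g (Z ω) (X n ω) ∂P
      = ∫ y, y.1.1 * g y.1.2 y.2 ∂(P.map (fun ω => ((U ω, Z ω), X n ω))) :=
    (integral_map hpair.aemeasurable hG.aestronglyMeasurable).symm
  have hint : Integrable (fun y : (ℝ × E) × 𝒳 => y.1.1 * g y.1.2 y.2)
      (P.map (fun ω => ((U ω, Z ω), X n ω))) := by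
    rw [integrable_map_measure hG.aestronglyMeasurable hpair.aemeasurable]
    refine Integrable.of_bound (hG.comp hpair).aestronglyMeasurable (C * B)
      (Eventually.of_forall fun ω => ?_)
    simp only [Function.comp, Real.norm_eq_abs, abs_mul]
    exact mul_le_mul (hUC ω) (hgB _ _) (abs_nonneg _) ((abs_nonneg _).trans (hUC ω))
  have : IsProbabilityMeasure (P.map (X n)) := Measure.isProbabilityMeasure_map (hX n).aemeasurable
  have : IsProbabilityMeasure (P.map (fun ω => (U ω, Z ω))) :=
    Measure.isProbabilityMeasure_map hUZm.aemeasurable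
  rw [key, hmap, integral_prod _ (hmap ▸ hint)]
  simp [integral_const_mul, hlaw, hg0]

/-- Almost sure convergence of a weighted series of centred bounded innovations with
square-summable weights. -/
theorem ae_exists_tendsto_sum_innovations {μ : Measure 𝒳} (hind : iIndepFun X P)
    (hlaw : ∀ n, P.map (X n) = μ) {Z : ℕ → Ω → E}
    (hZ : ∀ n, Measurable[strictPast X hX n] (Z n))
    {g : E → 𝒳 → ℝ} (hg : Measurable (Function.uncurry g)) {B : ℝ} (hgB : ∀ z x, |g z x| ≤ B)
    (hg0 : ∀ z, ∫ x, g z x ∂μ = 0) {w : ℕ → ℝ} (hw : Summable fun n => w n ^ 2) :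
    ∀ᵐ ω ∂P, ∃ l, Tendsto (fun n => ∑ i ∈ Finset.range n, w i * g (Z i ω) (X i ω))
      atTop (𝓝 l) := by
  set ℱ := strictPast X hX
  set M : ℕ → Ω → ℝ := fun n ω => ∑ i ∈ Finset.range n, w i * g (Z i ω) (X i ω) with hM
  have hstep : ∀ i n, i < n → Measurable[ℱ n] (fun ω => g (Z i ω) (X i ω)) := fun i n h =>
    hg.comp (((hZ i).mono (ℱ.mono h.le) le_rfl).prodMk (measurable_strictPast h))
  have hMm : ∀ n, Measurable[ℱ n] (M n) := fun n =>
    Finset.measurable_fun_sum _ fun i hi => (hstep i n (Finset.mem_range.1 hi)).const_mul _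
  have hMm' : ∀ n, Measurable (M n) := fun n => (hMm n).mono (ℱ.le n) le_rfl
  have hgm : ∀ n, Measurable (fun ω => g (Z n ω) (X n ω)) := fun n =>
    (hstep n (n + 1) n.lt_succ_self).mono (ℱ.le _) le_rfl
  have hMb : ∀ n ω, |M n ω| ≤ ∑ i ∈ Finset.range n, |w i| * B := fun n ω =>
    (Finset.abs_sum_le_sum_abs _ _).trans (Finset.sum_le_sum fun i _ => by
      rw [abs_mul]; exact mul_le_mul_of_nonneg_left (hgB _ _) (abs_nonneg _))
  have hMi : ∀ n, Integrable (M n) P := fun n =>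
    Integrable.of_bound (hMm' n).aestronglyMeasurable _ (Eventually.of_forall (hMb n))
  have hgi : ∀ n, Integrable (fun ω => g (Z n ω) (X n ω)) P := fun n =>
    Integrable.of_bound (hgm n).aestronglyMeasurable B (Eventually.of_forall fun ω => hgB _ _)
  have hsucc : ∀ n ω, M (n + 1) ω = M n ω + w n * g (Z n ω) (X n ω) := fun n ω => by
    simp [hM, Finset.sum_range_succ]
  have hmart : Martingale M ℱ P := by
    refine martingale_of_setIntegral_eq_succ (fun n => (hMm n).stronglyMeasurable) hMi ?_
    intro n s hs
    -- Orthogonality to indicators of past events is the martingale property.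
    have h0 := integral_mul_eq_zero_of_strictPast (Z := Z n) hind (hlaw n)
      (U := s.indicator (fun _ => (1 : ℝ))) (measurable_const.indicator hs) (hZ n) (C := 1)
      (fun ω => by by_cases h : ω ∈ s <;> simp [h]) hg hgB hg0
    have h1 : ∫ ω in s, g (Z n ω) (X n ω) ∂P = 0 := by
      rw [← h0, ← integral_indicator (ℱ.le n s hs)]
      congr 1 with ω
      by_cases h : ω ∈ s <;> simp [h]
    simp_rw [hsucc]
    rw [integral_add (hMi n).integrableOn ((hgi n).const_mul _).integrableOn,
      integral_const_mul, h1]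
    simp
  have hB : 0 ≤ B ^ 2 := sq_nonneg B
  have hsqi : ∀ n, Integrable (fun ω => M n ω ^ 2) P := fun n =>
    Integrable.of_bound ((hMm' n).pow_const 2).aestronglyMeasurable
      ((∑ i ∈ Finset.range n, |w i| * B) ^ 2) (Eventually.of_forall fun ω => by
        rw [Real.norm_eq_abs, abs_pow]
        exact pow_le_pow_left₀ (abs_nonneg _) (hMb n ω) 2)
  have hsq : ∀ n, ∫ ω, M n ω ^ 2 ∂P ≤ ∑ i ∈ Finset.range n, w i ^ 2 * B ^ 2 := by
    intro n
    induction n with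
    | zero => simp [hM]
    | succ n ih =>
      -- The cross term vanishes, so second moments grow only by `w n ^ 2 * B ^ 2`.
      have hcross := integral_mul_eq_zero_of_strictPast hind (hlaw n) (hMm n) (hZ n) (hMb n)
        hg hgB hg0
      have hci : Integrable (fun ω => M n ω * g (Z n ω) (X n ω)) P :=
        (hgi n).bdd_mul (hMm' n).aestronglyMeasurable (Eventually.of_forall (hMb n))
      have hadd : Integrable
          (fun ω => M n ω ^ 2 + 2 * w n * (M n ω * g (Z n ω) (X n ω))) P :=
        (hsqi n).add (hci.const_mul _)
      have hle : ∀ ω, M (n + 1) ω ^ 2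
          ≤ M n ω ^ 2 + 2 * w n * (M n ω * g (Z n ω) (X n ω)) + w n ^ 2 * B ^ 2 := fun ω => by
        have h2 : g (Z n ω) (X n ω) ^ 2 ≤ B ^ 2 := by
          rw [← sq_abs]; exact pow_le_pow_left₀ (abs_nonneg _) (hgB _ _) 2
        have := mul_le_mul_of_nonneg_left h2 (sq_nonneg (w n))
        rw [hsucc]; nlinarith
      calc ∫ ω, M (n + 1) ω ^ 2 ∂P
          ≤ ∫ ω, (M n ω ^ 2 + 2 * w n * (M n ω * g (Z n ω) (X n ω)) + w n ^ 2 * B ^ 2) ∂P :=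
            integral_mono (hsqi _) (hadd.add (integrable_const _)) hle
        _ = ∫ ω, M n ω ^ 2 ∂P + w n ^ 2 * B ^ 2 := by
            rw [integral_add hadd (integrable_const _),
              integral_add (hsqi n) (hci.const_mul _), integral_const_mul, hcross]
            simp
        _ ≤ _ := by rw [Finset.sum_range_succ]; linarith
  -- The `L¹` bound comes from the `L²` bound through `|M| ≤ 1 + M ^ 2`.
  have hR : ∀ n, eLpNorm (M n) 1 P ≤ (1 + (∑' i, w i ^ 2 * B ^ 2)).toNNReal := fun n => by
    rw [eLpNorm_one_eq_lintegral_enorm, ← ofReal_integral_norm_eq_lintegral_enorm (hMi n)]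
    refine ENNReal.ofReal_le_ofReal ?_
    calc ∫ ω, ‖M n ω‖ ∂P ≤ ∫ ω, (1 + M n ω ^ 2) ∂P :=
          integral_mono (hMi n).norm ((integrable_const _).add (hsqi n)) fun ω => by
            show |M n ω| ≤ 1 + M n ω ^ 2
            rw [← sq_abs]; nlinarith [sq_nonneg (|M n ω| - 1), abs_nonneg (M n ω)]
      _ = 1 + ∫ ω, M n ω ^ 2 ∂P := by
          rw [integral_add (integrable_const _) (hsqi n)]; simp
      _ ≤ _ := by
          have := (hw.mul_right (B ^ 2)).sum_le_tsum (Finset.range n)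
            (fun i _ => mul_nonneg (sq_nonneg (w i)) hB)
          linarith [hsq n]
  filter_upwards [hmart.submartingale.ae_tendsto_limitProcess hR] with ω hω
  exact ⟨_, hω⟩

end Noise

end NewtonMixing

end

noncomputable section

namespace NewtonMixing

/-! ### Deterministic Lyapunov argument -/

section Deterministic

/-- Only the minorant `v` has to be bounded, not `u`. The error follows from `log y ≥ 1 - 1 / y` at
`y = 1 - w + w * v ≥ 1 - w`, with `|v - 1| ≤ c + 1`. -/
theorem log_convex_comb_ge {w u v c : ℝ} (hw : w ∈ Set.Ioo (0 : ℝ) 1) (hv : 0 ≤ v) (hvu : v ≤ u)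
    (hvc : v ≤ c) :
    w * (v - 1) - (c + 1) ^ 2 * (w ^ 2 / (1 - w)) ≤ Real.log (1 - w + w * u) := by
  obtain ⟨h0, h1⟩ := hw
  have h1' : 0 < 1 - w := by linarith
  have hy : 0 < 1 - w + w * v := by positivity
  have hyu : 1 - w + w * v ≤ 1 - w + w * u := by gcongr
  refine le_trans ?_ (Real.log_le_log hy hyu)
  refine le_trans ?_ (Real.one_sub_inv_le_log_of_pos hy)
  have e : 1 - (1 - w + w * v)⁻¹ = w * (v - 1) - (w * (v - 1)) ^ 2 / (1 - w + w * v) := by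
    field_simp; ring
  rw [e]
  have h2 : (w * (v - 1)) ^ 2 / (1 - w + w * v) ≤ (c + 1) ^ 2 * (w ^ 2 / (1 - w)) := by
    rw [← mul_div_assoc]
    refine div_le_div₀ (by positivity) ?_ h1' (by nlinarith)
    rw [mul_pow, mul_comm]
    exact mul_le_mul_of_nonneg_right (by nlinarith) (sq_nonneg w)
  linarith

variable {Θ : Type*} [Fintype Θ]

/-- A quantitative Gibbs inequality, with the squared Hellinger distance as the gap. -/
theorem sum_mul_log_le_sub_hellinger {f φ : Θ → ℝ} (hf : f ∈ stdSimplex ℝ Θ)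
    (hφ : φ ∈ stdSimplex ℝ Θ) (hpos : ∀ θ, 0 < φ θ) :
    ∑ θ, f θ * Real.log (φ θ) + ∑ θ, (√(f θ) - √(φ θ)) ^ 2
      ≤ ∑ θ, f θ * Real.log (f θ) := by
  -- The correction `φ θ - f θ` sums to zero. For `f θ > 0` the bound is `log x ≤ x - 1` at `x = √(φ
  -- θ) / √(f θ)`.
  have key : ∀ θ, f θ * Real.log (φ θ) + (√(f θ) - √(φ θ)) ^ 2
      ≤ f θ * Real.log (f θ) + (φ θ - f θ) := by
    intro θ
    rcases (hf.1 θ).eq_or_lt with h | h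
    · simp [← h, Real.sq_sqrt (hpos θ).le]
    · have ha := Real.sqrt_pos.2 h
      have hb := Real.sqrt_pos.2 (hpos θ)
      have h1 := Real.log_le_sub_one_of_pos (div_pos hb ha)
      rw [Real.log_div hb.ne' ha.ne', Real.log_sqrt (hpos θ).le, Real.log_sqrt h.le] at h1
      have h2 := mul_le_mul_of_nonneg_left h1 h.le
      have h3 : f θ * (√(φ θ) / √(f θ) - 1) = √(f θ) * √(φ θ) - f θ := by
        conv_lhs => rw [← Real.mul_self_sqrt h.le]
        conv_rhs => rw [← Real.mul_self_sqrt h.le]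
        simp only [Real.sqrt_mul_self ha.le]
        field_simp
      have h4 := Real.mul_self_sqrt h.le
      have h5 := Real.mul_self_sqrt (hpos θ).le
      nlinarith
  have := Finset.sum_le_sum fun θ (_ : θ ∈ Finset.univ) => key θ
  simp only [Finset.sum_add_distrib, Finset.sum_sub_distrib, hf.2, hφ.2] at this
  linarith

/-- The Hellinger gap controls every coordinate, including those with `f θ = 0`, which the
logarithmic sum ignores. -/
theorem tendsto_of_tendsto_sum_mul_log {f : Θ → ℝ} (hf : f ∈ stdSimplex ℝ Θ) {φ : ℕ → Θ → ℝ}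
    (hφ : ∀ n, φ n ∈ stdSimplex ℝ Θ) (hpos : ∀ n θ, 0 < φ n θ)
    (h : Tendsto (fun n => ∑ θ, f θ * Real.log (φ n θ)) atTop
      (𝓝 (∑ θ, f θ * Real.log (f θ)))) : Tendsto φ atTop (𝓝 f) := by
  rw [tendsto_pi_nhds]
  intro θ
  have h0 : Tendsto (fun n => (√(f θ) - √(φ n θ)) ^ 2) atTop (𝓝 0) := by
    refine squeeze_zero (fun n => sq_nonneg _) (fun n => ?_)
      (by simpa using h.const_sub (∑ θ, f θ * Real.log (f θ)))
    have h1 := sum_mul_log_le_sub_hellinger hf (hφ n) (hpos n)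
    have h2 := Finset.single_le_sum (f := fun θ => (√(f θ) - √(φ n θ)) ^ 2)
      (fun i _ => sq_nonneg _) (Finset.mem_univ θ)
    linarith
  have h1 : Tendsto (fun n => √(f θ) - √(φ n θ)) atTop (𝓝 0) := by
    rw [tendsto_zero_iff_abs_tendsto_zero]
    simpa [Real.sqrt_sq_eq_abs, Function.comp_def] using h0.sqrt
  have h2 : Tendsto (fun n => √(φ n θ)) atTop (𝓝 √(f θ)) := by
    simpa using h1.const_sub √(f θ)
  have h3 := h2.pow 2
  simpa only [Real.sq_sqrt (hpos _ θ).le, Real.sq_sqrt (hf.1 θ)] using h3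

/-- A sequence in the simplex along which `∑ f log φ` increases, up to convergent perturbations,
at rate at least `w D`, converges to the only zero `f` of `D`. -/
theorem tendsto_of_drift {f : Θ → ℝ} (hf : f ∈ stdSimplex ℝ Θ) {φ : ℕ → Θ → ℝ}
    (hφ : ∀ n, φ n ∈ stdSimplex ℝ Θ) (hpos : ∀ n θ, 0 < φ n θ)
    {D : (Θ → ℝ) → ℝ} (hDc : ContinuousOn D (stdSimplex ℝ Θ))
    (hD0 : ∀ ψ ∈ stdSimplex ℝ Θ, 0 ≤ D ψ) (hDz : ∀ ψ ∈ stdSimplex ℝ Θ, D ψ = 0 → ψ = f)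
    {w ξ : ℕ → ℝ} (hw : ∀ n, 0 < w n)
    (hw_sum : Tendsto (fun n => ∑ i ∈ Finset.range n, w i) atTop atTop)
    (hξ : ∃ l, Tendsto (fun n => ∑ i ∈ Finset.range n, ξ i) atTop (𝓝 l))
    (hdrift : ∀ n, w n * D (φ n) + ξ n
      ≤ ∑ θ, f θ * Real.log (φ (n + 1) θ) - ∑ θ, f θ * Real.log (φ n θ)) :
    Tendsto φ atTop (𝓝 f) := by
  obtain ⟨l, hl⟩ := hξ
  set L : ℕ → ℝ := fun n => ∑ θ, f θ * Real.log (φ n θ) with hL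
  set A : ℕ → ℝ := fun n => L n - ∑ i ∈ Finset.range n, ξ i with hA
  have hLle : ∀ n, L n ≤ 0 := fun n => Finset.sum_nonpos fun θ _ =>
    mul_nonpos_of_nonneg_of_nonpos (hf.1 θ) (Real.log_nonpos (hpos n θ).le
      ((Finset.single_le_sum (fun i _ => (hφ n).1 i) (Finset.mem_univ θ)).trans (hφ n).2.le))
  have hAstep : ∀ n, w n * D (φ n) ≤ A (n + 1) - A n := fun n => by
    simp only [hA, Finset.sum_range_succ]; have := hdrift n; simp only [hL]; linarith
  have hAmono : Monotone A := monotone_nat_of_le_succ fun n => by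
    have := mul_nonneg (hw n).le (hD0 _ (hφ n)); linarith [hAstep n]
  obtain ⟨c, hc⟩ := hl.bddBelow_range
  have hAbdd : BddAbove (Set.range A) := by
    refine ⟨-c, ?_⟩
    rintro _ ⟨n, rfl⟩
    have := hc ⟨n, rfl⟩
    simp only [hA]; simp only at this; linarith [hLle n]
  have hAlim := tendsto_atTop_ciSup hAmono hAbdd
  have hLlim : Tendsto L atTop (𝓝 ((⨆ n, A n) + l)) := by
    simpa [hA] using hAlim.add hl
  have hsumle : ∀ n, ∑ i ∈ Finset.range n, w i * D (φ i) ≤ (⨆ n, A n) - A 0 := fun n => by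
    refine (Finset.sum_le_sum fun i _ => hAstep i).trans ?_
    rw [Finset.sum_range_sub]
    linarith [le_ciSup hAbdd n]
  -- The sums of `w i * D (φ i)` are bounded while those of `w i` diverge.
  have hfreq : ∀ δ > 0, ∃ᶠ n in atTop, D (φ n) < δ := by
    intro δ hδ hcon
    simp only [not_lt] at hcon
    obtain ⟨N, hN⟩ := eventually_atTop.1 hcon
    have hbound : ∀ n ≥ N, δ * (∑ i ∈ Finset.range n, w i - ∑ i ∈ Finset.range N, w i)
        ≤ (⨆ n, A n) - A 0 := fun n hn => by
      refine le_trans ?_ (hsumle n)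
      rw [← Finset.sum_Ico_eq_sub _ hn, Finset.mul_sum]
      calc ∑ i ∈ Finset.Ico N n, δ * w i ≤ ∑ i ∈ Finset.Ico N n, w i * D (φ i) :=
            Finset.sum_le_sum fun i hi => by
              rw [mul_comm]
              exact mul_le_mul_of_nonneg_left (hN i (Finset.mem_Ico.1 hi).1) (hw i).le
        _ ≤ _ := Finset.sum_le_sum_of_subset_of_nonneg
            (fun i hi => Finset.mem_range.2 (Finset.mem_Ico.1 hi).2)
            (fun i _ _ => mul_nonneg (hw i).le (hD0 _ (hφ i)))
    have hlarge : Tendsto (fun n => δ * (∑ i ∈ Finset.range n, w i - ∑ i ∈ Finset.range N, w i))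
        atTop atTop :=
      (tendsto_atTop_add_const_right _ _ hw_sum).const_mul_atTop hδ
    obtain ⟨n, hn, hn'⟩ :=
      ((hlarge.eventually_gt_atTop ((⨆ n, A n) - A 0)).and (eventually_ge_atTop N)).exists
    exact absurd (hbound n hn') (not_le.2 hn)
  have hcluster : ∀ U ∈ 𝓝 f, ∃ᶠ n in atTop, φ n ∈ U := by
    intro U hU
    obtain ⟨V, hVU, hVo, hfV⟩ := mem_nhds_iff.1 hU
    have hK : IsCompact (stdSimplex ℝ Θ \ V) := (isCompact_stdSimplex ℝ Θ).diff hVo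
    rcases (stdSimplex ℝ Θ \ V).eq_empty_or_nonempty with he | hne
    · refine Eventually.frequently (Eventually.of_forall fun n => hVU ?_)
      by_contra hn
      exact (he ▸ (⟨hφ n, hn⟩ : φ n ∈ stdSimplex ℝ Θ \ V) : φ n ∈ (∅ : Set (Θ → ℝ)))
    · obtain ⟨ψ, hψ, hmin⟩ := hK.exists_isMinOn hne (hDc.mono Set.sdiff_subset)
      have hψpos : 0 < D ψ := (hD0 ψ hψ.1).lt_of_ne fun h => by
        rw [hDz ψ hψ.1 h.symm] at hψ; exact hψ.2 hfV
      refine (hfreq _ hψpos).mono fun n hn => hVU ?_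
      by_contra hnV
      exact absurd (hmin ⟨hφ n, hnV⟩ : D ψ ≤ D (φ n)) (not_le.2 hn)
  -- Terms with `f θ = 0` vanish identically, so the singularity of `log` at `0` is harmless.
  have hcont : ContinuousAt (fun ψ : Θ → ℝ => ∑ θ, f θ * Real.log (ψ θ)) f := by
    refine tendsto_finsetSum _ fun θ _ => ?_
    rcases eq_or_ne (f θ) 0 with h | h
    · simp [h]
    · exact (((continuous_apply θ).tendsto f).log h).const_mul _
  have hmap : MapClusterPt (∑ θ, f θ * Real.log (f θ)) atTop L := by
    rw [mapClusterPt_iff_frequently]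
    exact fun s hs => hcluster _ (hcont hs)
  have heq : ∑ θ, f θ * Real.log (f θ) = (⨆ n, A n) + l := by
    obtain ⟨k, hk, hkl⟩ := hmap.tendsto_subseq
    exact tendsto_nhds_unique hkl (hLlim.comp hk.tendsto_atTop)
  exact tendsto_of_tendsto_sum_mul_log hf hφ hpos (heq ▸ hLlim)

end Deterministic

end NewtonMixing

end

noncomputable section

namespace NewtonMixing

/-! ### Mixture densities, the capped ratio and its drift -/

section Mixture

variable {𝒳 Θ : Type*} [Fintype Θ] {p : 𝒳 → Θ → ℝ} {f φ : Θ → ℝ} {x : 𝒳}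

theorem mixture_nonneg (hp : ∀ θ, 0 ≤ p x θ) (hφ : ∀ θ, 0 ≤ φ θ) : 0 ≤ mixture p φ x :=
  Finset.sum_nonneg fun θ _ => mul_nonneg (hp θ) (hφ θ)

theorem mixture_pos (hp : ∀ θ, 0 < p x θ) (hφ : φ ∈ stdSimplex ℝ Θ) : 0 < mixture p φ x := by
  refine (mixture_nonneg (fun θ => (hp θ).le) hφ.1).lt_of_ne fun h => ?_
  have h0 := (Finset.sum_eq_zero_iff_of_nonneg
    fun θ _ => mul_nonneg (hp θ).le (hφ.1 θ)).1 h.symm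
  have h1 : ∑ θ, φ θ = 0 := Finset.sum_eq_zero fun θ hθ =>
    (mul_eq_zero.1 (h0 θ hθ)).resolve_left (hp θ).ne'
  exact zero_ne_one (h1.symm.trans hφ.2)

/-- The ratio `Π_f / Π_φ` capped at `2`. -/
def cappedRatio (p : 𝒳 → Θ → ℝ) (f φ : Θ → ℝ) (x : 𝒳) : ℝ :=
  min (mixture p f x / |mixture p φ x|) 2

/-- The absolute value in the denominator makes this valid off the simplex too; the noise lemma
needs bounds for every state `φ`. -/
theorem cappedRatio_nonneg (hp : ∀ θ, 0 ≤ p x θ) (hf : f ∈ stdSimplex ℝ Θ) (φ : Θ → ℝ) :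
    0 ≤ cappedRatio p f φ x :=
  le_min (div_nonneg (mixture_nonneg hp hf.1) (abs_nonneg _)) zero_le_two

theorem cappedRatio_le_two : cappedRatio p f φ x ≤ 2 := min_le_right _ _

theorem abs_cappedRatio_le_two (hp : ∀ θ, 0 ≤ p x θ) (hf : f ∈ stdSimplex ℝ Θ) (φ : Θ → ℝ) :
    |cappedRatio p f φ x| ≤ 2 := by
  rw [abs_of_nonneg (cappedRatio_nonneg hp hf φ)]; exact cappedRatio_le_two

/-- The integrand of the drift, written with respect to `ν`. -/
theorem mixture_mul_cappedRatio_gap (hφ : 0 < mixture p φ x) :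
    0 ≤ mixture p f x * cappedRatio p f φ x - 2 * mixture p f x + mixture p φ x ∧
    (mixture p f x * cappedRatio p f φ x - 2 * mixture p f x + mixture p φ x = 0 →
      mixture p φ x = mixture p f x) := by
  simp only [cappedRatio, abs_of_pos hφ]
  set a := mixture p f x
  set t := mixture p φ x
  rcases le_total (a / t) 2 with h | h
  · have e : a * min (a / t) 2 - 2 * a + t = (t - a) ^ 2 / t := by
      rw [min_eq_left h]; field_simp; ring
    rw [e]
    refine ⟨by positivity, fun h0 => ?_⟩
    rcases div_eq_zero_iff.1 h0 with h1 | h1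
    · exact sub_eq_zero.1 (pow_eq_zero_iff two_ne_zero |>.1 h1)
    · exact absurd h1 hφ.ne'
  · rw [min_eq_right h]
    exact ⟨by linarith, fun h0 => by linarith⟩

/-- One step of the recursion increases `∑ f log φ` by at least the weighted centred capped
ratio, up to a second-order term. -/
theorem newton_step_gain (hp : ∀ θ, 0 < p x θ) (hf : f ∈ stdSimplex ℝ Θ)
    (hφ : φ ∈ stdSimplex ℝ Θ) (hpos : ∀ θ, 0 < φ θ) {w : ℝ} (hw : w ∈ Set.Ioo (0 : ℝ) 1) :
    w * (cappedRatio p f φ x - 1)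
        - (∑ θ, f θ * (2 / f θ + 1) ^ 2) * (w ^ 2 / (1 - w))
      ≤ ∑ θ, f θ * Real.log ((1 - w) * φ θ + w * (p x θ * φ θ / mixture p φ x))
        - ∑ θ, f θ * Real.log (φ θ) := by
  have ha := mixture_pos hp hf
  have ht := mixture_pos hp hφ
  have hc0 := cappedRatio_nonneg (fun θ => (hp θ).le) hf φ
  -- Here `v = p / Π_f * R` and `c = 2 / f θ`. If `f θ = 0`, both sides are zero.
  have key : ∀ θ, f θ * (w * (p x θ / mixture p f x * cappedRatio p f φ x - 1)
        - (2 / f θ + 1) ^ 2 * (w ^ 2 / (1 - w)))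
      ≤ f θ * Real.log ((1 - w) * φ θ + w * (p x θ * φ θ / mixture p φ x))
        - f θ * Real.log (φ θ) := by
    intro θ
    rcases (hf.1 θ).eq_or_lt with h | h
    · simp [← h]
    have e : (1 - w) * φ θ + w * (p x θ * φ θ / mixture p φ x)
        = φ θ * (1 - w + w * (p x θ / mixture p φ x)) := by ring
    have hy : 0 < 1 - w + w * (p x θ / mixture p φ x) :=
      add_pos (sub_pos.2 hw.2) (mul_pos hw.1 (div_pos (hp θ) ht))
    rw [e, Real.log_mul (hpos θ).ne' hy.ne', mul_add, add_sub_cancel_left]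
    refine mul_le_mul_of_nonneg_left (log_convex_comb_ge hw
      (mul_nonneg (div_pos (hp θ) ha).le hc0) ?_ ?_) h.le
    · have h1 : cappedRatio p f φ x ≤ mixture p f x / mixture p φ x := by
        unfold cappedRatio; rw [abs_of_pos ht]; exact min_le_left _ _
      refine (mul_le_mul_of_nonneg_left h1 (div_pos (hp θ) ha).le).trans_eq ?_
      field_simp
    · have h1 : p x θ / mixture p f x ≤ 1 / f θ := by
        rw [div_le_div_iff₀ ha h, one_mul]
        exact Finset.single_le_sum (f := fun θ => p x θ * f θ)
          (fun i _ => mul_nonneg (hp i).le (hf.1 i)) (Finset.mem_univ θ)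
      refine (mul_le_mul h1 cappedRatio_le_two hc0 (by positivity)).trans_eq ?_
      ring
  have hsum := Finset.sum_le_sum fun θ (_ : θ ∈ Finset.univ) => key θ
  rw [Finset.sum_sub_distrib] at hsum
  refine le_trans (le_of_eq ?_) hsum
  have h1 : ∑ θ, f θ * (w * (p x θ / mixture p f x * cappedRatio p f φ x - 1)
        - (2 / f θ + 1) ^ 2 * (w ^ 2 / (1 - w)))
      = w * (cappedRatio p f φ x / mixture p f x) * (∑ θ, p x θ * f θ) - w * ∑ θ, f θ
        - (∑ θ, f θ * (2 / f θ + 1) ^ 2) * (w ^ 2 / (1 - w)) := by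
    rw [Finset.mul_sum, Finset.mul_sum, Finset.sum_mul, ← Finset.sum_sub_distrib,
      ← Finset.sum_sub_distrib]
    exact Finset.sum_congr rfl fun θ _ => by ring
  rw [h1, hf.2]
  change _ = w * (cappedRatio p f φ x / mixture p f x) * mixture p f x - _ - _
  field_simp

theorem newtonEstimate_mem {w : ℕ → ℝ} (hw : ∀ n, w n ∈ Set.Ioo (0 : ℝ) 1) {f₀ : Θ → ℝ}
    (hf₀ : f₀ ∈ stdSimplex ℝ Θ) (hf₀_pos : ∀ θ, 0 < f₀ θ) {x : ℕ → 𝒳}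
    (hx : ∀ n θ, 0 < p (x n) θ) (n : ℕ) :
    newtonEstimate p w f₀ x n ∈ stdSimplex ℝ Θ ∧ ∀ θ, 0 < newtonEstimate p w f₀ x n θ := by
  induction n with
  | zero => exact ⟨hf₀, hf₀_pos⟩
  | succ n ih =>
    obtain ⟨hmem, hpos⟩ := ih
    have ht := mixture_pos (hx n) hmem
    have hpos' : ∀ θ, 0 < newtonEstimate p w f₀ x (n + 1) θ := fun θ =>
      add_pos (mul_pos (sub_pos.2 (hw n).2) (hpos θ))
        (mul_pos (hw n).1 (div_pos (mul_pos (hx n θ) (hpos θ)) ht))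
    refine ⟨⟨fun θ => (hpos' θ).le, ?_⟩, hpos'⟩
    simp only [newtonEstimate, Finset.sum_add_distrib, ← Finset.mul_sum, ← Finset.sum_div]
    rw [hmem.2]
    change _ + w n * (mixture p _ (x n) / _) = 1
    rw [div_self ht.ne']; ring

variable [MeasurableSpace 𝒳] {ν : Measure 𝒳}

theorem measurable_uncurry_mixture (hp : ∀ θ, Measurable fun x => p x θ) :
    Measurable (fun y : (Θ → ℝ) × 𝒳 => mixture p y.1 y.2) :=
  Finset.measurable_fun_sum _ fun θ _ =>
    ((hp θ).comp measurable_snd).mul ((measurable_pi_apply θ).comp measurable_fst)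

theorem measurable_mixture (hp : ∀ θ, Measurable fun x => p x θ) (φ : Θ → ℝ) :
    Measurable (mixture p φ) :=
  (measurable_uncurry_mixture hp).comp measurable_prodMk_left

theorem measurable_uncurry_cappedRatio (hp : ∀ θ, Measurable fun x => p x θ) (f : Θ → ℝ) :
    Measurable (fun y : (Θ → ℝ) × 𝒳 => cappedRatio p f y.1 y.2) :=
  (((measurable_mixture hp f).comp measurable_snd).div
    (measurable_uncurry_mixture hp).abs).min measurable_const

theorem measurable_cappedRatio (hp : ∀ θ, Measurable fun x => p x θ) (f φ : Θ → ℝ) :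
    Measurable (cappedRatio p f φ) :=
  (measurable_uncurry_cappedRatio hp f).comp measurable_prodMk_left

theorem IsProbDensity.integrable {g : 𝒳 → ℝ} (hg : IsProbDensity ν g) : Integrable g ν := by
  refine ⟨hg.measurable.aestronglyMeasurable, ?_⟩
  rw [hasFiniteIntegral_iff_ofReal (Eventually.of_forall hg.nonneg), hg.lintegral_eq_one]
  exact ENNReal.one_lt_top

theorem IsProbDensity.integral_eq_one {g : 𝒳 → ℝ} (hg : IsProbDensity ν g) :
    ∫ x, g x ∂ν = 1 := by
  rw [integral_eq_lintegral_of_nonneg_ae (Eventually.of_forall hg.nonneg)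
    hg.measurable.aestronglyMeasurable, hg.lintegral_eq_one, ENNReal.toReal_one]

theorem integrable_mixture (hp : ∀ θ, IsProbDensity ν fun x => p x θ) (φ : Θ → ℝ) :
    Integrable (mixture p φ) ν :=
  integrable_finsetSum _ fun θ _ => (hp θ).integrable.mul_const _

theorem integral_mixture (hp : ∀ θ, IsProbDensity ν fun x => p x θ) (hφ : φ ∈ stdSimplex ℝ Θ) :
    ∫ x, mixture p φ x ∂ν = 1 := by
  unfold mixture
  rw [integral_finsetSum _ fun θ _ => (hp θ).integrable.mul_const _]
  simp only [integral_mul_const, (hp _).integral_eq_one, one_mul, hφ.2]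

/-- The distribution with density `Π_f`. -/
def mixtureLaw (ν : Measure 𝒳) (p : 𝒳 → Θ → ℝ) (f : Θ → ℝ) : Measure 𝒳 :=
  ν.withDensity fun x => ENNReal.ofReal (mixture p f x)

theorem isProbabilityMeasure_mixtureLaw (hp : ∀ θ, IsProbDensity ν fun x => p x θ)
    (hf : f ∈ stdSimplex ℝ Θ) : IsProbabilityMeasure (mixtureLaw ν p f) := by
  constructor
  rw [mixtureLaw, withDensity_apply _ MeasurableSet.univ, Measure.restrict_univ,
    ← ofReal_integral_eq_lintegral_ofReal (integrable_mixture hp f)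
      (Eventually.of_forall fun x => mixture_nonneg (fun θ => (hp θ).nonneg x) hf.1),
    integral_mixture hp hf, ENNReal.ofReal_one]

/-- The mean increment of the capped ratio, a Lyapunov drift that vanishes only at `f`. -/
def drift (ν : Measure 𝒳) (p : 𝒳 → Θ → ℝ) (f φ : Θ → ℝ) : ℝ :=
  ∫ x, cappedRatio p f φ x ∂(mixtureLaw ν p f) - 1

theorem integrable_mixture_mul_cappedRatio (hp : ∀ θ, IsProbDensity ν fun x => p x θ)
    (hf : f ∈ stdSimplex ℝ Θ) (φ : Θ → ℝ) :
    Integrable (fun x => mixture p f x * cappedRatio p f φ x) ν :=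
  (integrable_mixture hp f).mul_bdd
    (measurable_cappedRatio (fun θ => (hp θ).measurable) f φ).aestronglyMeasurable
    (Eventually.of_forall fun x => abs_cappedRatio_le_two (fun θ => (hp θ).nonneg x) hf φ)

theorem integrable_gap (hp : ∀ θ, IsProbDensity ν fun x => p x θ)
    (hf : f ∈ stdSimplex ℝ Θ) (φ : Θ → ℝ) :
    Integrable (fun x => mixture p f x * cappedRatio p f φ x - 2 * mixture p f x
      + mixture p φ x) ν :=
  ((integrable_mixture_mul_cappedRatio hp hf φ).sub ((integrable_mixture hp f).const_mul 2)).add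
    (integrable_mixture hp φ)

/-- Both mixtures have mass one, so subtracting `2 Π_f` and adding `Π_φ` accounts for the `-1` and
makes the integrand nonnegative pointwise wherever `Π_φ > 0`. -/
theorem drift_eq_integral_gap (hp : ∀ θ, IsProbDensity ν fun x => p x θ)
    (hf : f ∈ stdSimplex ℝ Θ) (hφ : φ ∈ stdSimplex ℝ Θ) :
    drift ν p f φ
      = ∫ x, (mixture p f x * cappedRatio p f φ x - 2 * mixture p f x + mixture p φ x) ∂ν := by
  have h1 := integrable_mixture_mul_cappedRatio hp hf φ
  have h2 := (integrable_mixture hp f).const_mul 2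
  have h3 : Integrable (fun x => mixture p f x * cappedRatio p f φ x - 2 * mixture p f x) ν :=
    h1.sub h2
  rw [integral_add h3 (integrable_mixture hp φ), integral_sub h1 h2, integral_const_mul,
    integral_mixture hp hf, integral_mixture hp hφ, drift, mixtureLaw,
    integral_withDensity_eq_integral_toReal_smul
      (measurable_mixture (fun θ => (hp θ).measurable) f).ennreal_ofReal
      (Eventually.of_forall fun x => ENNReal.ofReal_lt_top)]
  simp only [smul_eq_mul, ENNReal.toReal_ofReal
    (mixture_nonneg (fun θ => (hp θ).nonneg _) hf.1)]
  ring

theorem drift_nonneg (hp : ∀ θ, IsProbDensity ν fun x => p x θ)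
    (hp_pos : ∀ᵐ x ∂ν, ∀ θ, 0 < p x θ) (hf : f ∈ stdSimplex ℝ Θ) (hφ : φ ∈ stdSimplex ℝ Θ) :
    0 ≤ drift ν p f φ := by
  rw [drift_eq_integral_gap hp hf hφ]
  exact integral_nonneg_of_ae (hp_pos.mono fun x hx =>
    (mixture_mul_cappedRatio_gap (mixture_pos hx hφ)).1)

theorem eq_of_drift_eq_zero (hp : ∀ θ, IsProbDensity ν fun x => p x θ)
    (hp_pos : ∀ᵐ x ∂ν, ∀ θ, 0 < p x θ) (h_ident : Identifiable ν p)
    (hf : f ∈ stdSimplex ℝ Θ) (hφ : φ ∈ stdSimplex ℝ Θ) (h : drift ν p f φ = 0) : φ = f := by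
  rw [drift_eq_integral_gap hp hf hφ, integral_eq_zero_iff_of_nonneg_ae
    (hp_pos.mono fun x hx =>
      (mixture_mul_cappedRatio_gap (mixture_pos hx hφ)).1)
    (integrable_gap hp hf φ)] at h
  refine h_ident φ hφ f hf ?_
  filter_upwards [hp_pos, h] with x hx h0
  exact (mixture_mul_cappedRatio_gap (mixture_pos hx hφ)).2 h0

theorem continuousOn_drift (hp : ∀ θ, IsProbDensity ν fun x => p x θ)
    (hp_pos : ∀ᵐ x ∂ν, ∀ θ, 0 < p x θ) (hf : f ∈ stdSimplex ℝ Θ) :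
    ContinuousOn (drift ν p f) (stdSimplex ℝ Θ) := by
  have := isProbabilityMeasure_mixtureLaw hp hf
  refine ContinuousOn.sub (continuousOn_of_dominated (bound := fun _ => 2) ?_ ?_
    (integrable_const _) ?_) continuousOn_const
  · exact fun φ _ =>
      (measurable_cappedRatio (fun θ => (hp θ).measurable) f φ).aestronglyMeasurable
  · exact fun φ _ => Eventually.of_forall fun x =>
      abs_cappedRatio_le_two (fun θ => (hp θ).nonneg x) hf φ
  · filter_upwards [(withDensity_absolutelyContinuous ν _).ae_le hp_pos] with x hx
    have hc : Continuous (fun φ : Θ → ℝ => mixture p φ x) :=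
      continuous_finsetSum _ fun θ _ => continuous_const.mul (continuous_apply θ)
    have hdiv : ContinuousOn (fun φ => mixture p f x / |mixture p φ x|) (stdSimplex ℝ Θ) :=
      continuousOn_const.div hc.abs.continuousOn
        fun φ hφ => (abs_pos.2 (mixture_pos hx hφ).ne').ne'
    exact hdiv.inf continuousOn_const

/-- The `n`-th estimate uses only observations with index below `n`, hence is independent of `X n`.
-/
theorem measurable_newtonEstimate {Ω : Type*} [MeasurableSpace Ω]
    (hp : ∀ θ, Measurable fun x => p x θ) (w : ℕ → ℝ) (f₀ : Θ → ℝ)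
    {X : ℕ → Ω → 𝒳} (hX : ∀ n, Measurable (X n)) (n : ℕ) :
    Measurable[strictPast X hX n] (fun ω => newtonEstimate p w f₀ (fun i => X i ω) n) := by
  induction n with
  | zero => exact measurable_const
  | succ n ih =>
    have ihn : Measurable[strictPast X hX (n + 1)]
        (fun ω => newtonEstimate p w f₀ (fun i => X i ω) n) :=
      ih.mono ((strictPast X hX).mono n.le_succ) le_rfl
    have hXn : Measurable[strictPast X hX (n + 1)] (X n) := measurable_strictPast n.lt_succ_self
    refine @measurable_pi_lambda _ _ _ (strictPast X hX (n + 1)) _ _ fun θ => ?_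
    have hθ := (measurable_pi_apply θ).comp ihn
    exact (hθ.const_mul (1 - w n)).add (((((hp θ).comp hXn).mul hθ).div
      ((measurable_uncurry_mixture hp).comp (ihn.prodMk hXn))).const_mul (w n))

/-- The weighted sum of the centred capped ratios along the recursion converges almost surely. -/
theorem ae_exists_tendsto_sum_cappedRatio {Ω : Type*} [MeasurableSpace Ω] {P : Measure Ω}
    [IsProbabilityMeasure P] (hp : ∀ θ, IsProbDensity ν fun x => p x θ)
    (hf : f ∈ stdSimplex ℝ Θ) {X : ℕ → Ω → 𝒳} (hX : ∀ n, Measurable (X n))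
    (hlaw : ∀ n, P.map (X n) = mixtureLaw ν p f) (hind : iIndepFun X P)
    {w : ℕ → ℝ} (hw_sq : Summable fun n => w n ^ 2) (f₀ : Θ → ℝ) :
    ∀ᵐ ω ∂P, ∃ l, Tendsto (fun n => ∑ i ∈ Finset.range n, w i *
      (cappedRatio p f (newtonEstimate p w f₀ (fun k => X k ω) i) (X i ω)
        - ∫ y, cappedRatio p f (newtonEstimate p w f₀ (fun k => X k ω) i) y
            ∂(mixtureLaw ν p f))) atTop (𝓝 l) := by
  have hpm : ∀ θ, Measurable fun x => p x θ := fun θ => (hp θ).measurable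
  have := isProbabilityMeasure_mixtureLaw hp hf
  have hcap := measurable_uncurry_cappedRatio hpm f
  have hg : Measurable (Function.uncurry fun φ x =>
      cappedRatio p f φ x - ∫ y, cappedRatio p f φ y ∂(mixtureLaw ν p f)) :=
    hcap.sub ((hcap.stronglyMeasurable.integral_prod_right').measurable.comp measurable_fst)
  have hcapi : ∀ φ, Integrable (cappedRatio p f φ) (mixtureLaw ν p f) := fun φ =>
    Integrable.of_bound (measurable_cappedRatio hpm f φ).aestronglyMeasurable 2
      (Eventually.of_forall fun x => abs_cappedRatio_le_two (fun θ => (hp θ).nonneg x) hf φ)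
  have hgB : ∀ φ x,
      |cappedRatio p f φ x - ∫ y, cappedRatio p f φ y ∂(mixtureLaw ν p f)| ≤ 2 + 2 := by
    intro φ x
    refine (abs_sub _ _).trans (add_le_add
      (abs_cappedRatio_le_two (fun θ => (hp θ).nonneg x) hf φ) ?_)
    have := norm_integral_le_of_norm_le_const (μ := mixtureLaw ν p f) (f := cappedRatio p f φ) (Eventually.of_forall
      fun y => abs_cappedRatio_le_two (fun θ => (hp θ).nonneg y) hf φ)
    simpa using this
  exact ae_exists_tendsto_sum_innovations (μ := mixtureLaw ν p f) (hX := hX) hind hlaw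
    (fun n => measurable_newtonEstimate hpm w f₀ hX n) (g := fun φ x =>
      cappedRatio p f φ x - ∫ y, cappedRatio p f φ y ∂(mixtureLaw ν p f)) hg hgB
    (fun φ => by rw [integral_sub (hcapi φ) (integrable_const _)]; simp) hw_sq

theorem summable_sq_div_one_sub {w : ℕ → ℝ} (hw_sq : Summable fun n => w n ^ 2) :
    Summable fun n => w n ^ 2 / (1 - w n) := by
  have h0 : Tendsto w atTop (𝓝 0) := by
    rw [tendsto_zero_iff_abs_tendsto_zero]
    simpa [Real.sqrt_sq_eq_abs, Function.comp_def] using hw_sq.tendsto_atTop_zero.sqrt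
  refine Summable.of_norm_bounded_eventually_nat (hw_sq.mul_left 2) ?_
  filter_upwards [h0.eventually (gt_mem_nhds (by norm_num : (0 : ℝ) < 1 / 2))] with n hn
  have h1 : 0 < 1 - w n := by linarith
  rw [Real.norm_of_nonneg (by positivity), div_le_iff₀ h1]
  nlinarith [sq_nonneg (w n)]

end Mixture

end NewtonMixing

end

theorem theorem3p4 {𝒳 Θ Ω : Type*} [MeasurableSpace 𝒳] [Fintype Θ] [MeasurableSpace Ω]
    (ν : Measure 𝒳) [SigmaFinite ν]
    (p : 𝒳 → Θ → ℝ)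
    (hp : ∀ θ, NewtonMixing.IsProbDensity ν (fun x => p x θ))
    (hp_pos : ∀ θ, ∀ᵐ x ∂ν, 0 < p x θ)
    (h_ident : NewtonMixing.Identifiable ν p)
    (f : Θ → ℝ) (hf : f ∈ stdSimplex ℝ Θ)
    (P : Measure Ω) [IsProbabilityMeasure P]
    (X : ℕ → Ω → 𝒳)
    (hX_law : ∀ n,
      HasLaw (X n) (ν.withDensity fun x => ENNReal.ofReal (NewtonMixing.mixture p f x)) P)
    (hX_indep : iIndepFun X P)
    (w : ℕ → ℝ) (hw : ∀ n, w n ∈ Set.Ioo (0 : ℝ) 1)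
    (hw_sum : Tendsto (fun n => ∑ i ∈ Finset.range n, w i) atTop atTop)
    (hw_sq : Summable fun n => w n ^ 2)
    (f₀ : Θ → ℝ) (hf₀ : f₀ ∈ stdSimplex ℝ Θ) (hf₀_pos : ∀ θ, 0 < f₀ θ) :
    ∀ᵐ ω ∂P,
      Tendsto (fun n => NewtonMixing.newtonEstimate p w f₀ (fun i => X i ω) n) atTop (𝓝 f) := by
  open NewtonMixing in
  have hpos : ∀ᵐ x ∂ν, ∀ θ, 0 < p x θ := ae_all_iff.2 hp_pos
  -- `HasLaw` gives only a.e. measurability; the filtration requires measurable versions.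
  obtain ⟨Y, hYX⟩ : ∃ Y : ℕ → Ω → 𝒳, ∀ n, Measurable (Y n) ∧ X n =ᵐ[P] Y n :=
    ⟨fun n => (hX_law n).aemeasurable.mk (X n), fun n =>
      ⟨(hX_law n).aemeasurable.measurable_mk, (hX_law n).aemeasurable.ae_eq_mk⟩⟩
  have hY := fun n => (hYX n).1
  have hXY := fun n => (hYX n).2
  have hlaw : ∀ n, P.map (Y n) = mixtureLaw ν p f := fun n => by
    rw [← Measure.map_congr (hXY n)]; exact (hX_law n).map_eq
  have hnoise := ae_exists_tendsto_sum_cappedRatio hp hf hY hlaw (hX_indep.congr hXY) hw_sq f₀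
  have hYpos : ∀ n, ∀ᵐ ω ∂P, ∀ θ, 0 < p (Y n ω) θ := fun n =>
    ae_of_ae_map (hY n).aemeasurable (by
      rw [hlaw n]; exact (withDensity_absolutelyContinuous ν _).ae_le hpos)
  filter_upwards [hnoise, ae_all_iff.2 hYpos, ae_all_iff.2 hXY] with ω hω hωpos hωXY
  simp only [hωXY]
  have hmem := newtonEstimate_mem hw hf₀ hf₀_pos hωpos
  obtain ⟨l, hl⟩ := hω
  have hsecond := ((summable_sq_div_one_sub hw_sq).mul_left
    (∑ θ, f θ * (2 / f θ + 1) ^ 2)).hasSum.tendsto_sum_nat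
  -- The perturbation is the martingale increment minus the summable second-order error.
  have hξ := (hl.sub hsecond).congr fun n => (Finset.sum_sub_distrib _ _).symm
  refine tendsto_of_drift hf (fun n => (hmem n).1) (fun n => (hmem n).2)
    (continuousOn_drift hp hpos hf) (fun ψ hψ => drift_nonneg hp hpos hf hψ)
    (fun ψ hψ => eq_of_drift_eq_zero hp hpos h_ident hf hψ) (fun n => (hw n).1) hw_sum
    ⟨_, hξ⟩ fun n => ?_
  have hgain := newton_step_gain (hωpos n) hf (hmem n).1 (hmem n).2 (hw n)
  simp only [newtonEstimate, drift]
  linarith
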